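/- **Setting.** Let $0\le\epsilon<1/6$ and let $fl:\mathbb R\to\mathbb R$ satisfy $|fl(x)-x|\le\epsilon|x|$ for all $x$; every primitive operation $x\circ y$, $\circ\in\{-,\cdot\}$, is computed as $fl(x\circ y)$. Put $\gamma_6=\frac{6\epsilon}{1-6\epsilon}$. For points of $\mathbb R^2$ let $\widehat{rt}(p,u,q)$ be the floating-point evaluation of $(p_x-u_x)(q_y-p_y)>(p_y-u_y)(q_x-p_x)$ ("$u$ is to the left of $pq$") and $\widehat{frt}(p,q,u,u')$ that of $(q_y-p_y)(u_x-u'_x)<(q_x-p_x)(u_y-u'_y)$ ("$u$ is farther from $pq$ than $u'$"). *Reduction.* $\mathrm{reduce}_{p,q}(L)$ is the point selected from a nonempty finite list $L$ by comparisons with $\widehat{frt}(p,q,\cdot,\cdot)$ in one of three evaluation orders: a sequential pass, blocks of length $m\ge1$ (the winner of each block is compared with the running candidate), or recursive halving (pairwise). Correspondingly let $c(n)=n-1$, $c(n)=m+n/m$, $c(n)=\lceil\log_2 n\rceil$. A function $F:\mathbb N\to\mathbb R$, $n\mapsto F_n$, is a *reduction bound* if $\bigl(d(r,pq)-d(\hat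 r,pq)\bigr)/M'\le F_n$ for all $p\ne q$, every list $L$ of $n\ge1$ points strictly to the left of $pq$, every $r\in L$ and $\hat r=\mathrm{reduce}_{p,q}(L)$, where $d(\cdot,pq)$ is the distance to the line through $p,q$ and $M'$ is the maximal absolute value of the coordinates of $p,q$ and the points of $L$. *Algorithm.* HULL$(L,p,r,q)$ returns $L$ if $|L|\le1$. Otherwise, with $S_1=\{u\in L:\widehat{rt}(p,u,r)\}$, $S_2=\{u\in L:\widehat{rt}(r,u,q)\}$, $r_1=\mathrm{reduce}_{p,r}(S_1)$, $r_2=\mathrm{reduce}_{r,q}(S_2)$, it returns $\{p\}\cup$HULL$(S_1,p,r_1,r)\cup\{r\}\cup$HULL$(S_2,r,r_2,q)\cup\{q\}$. Its depth is $0$ in the first case and one more than the maximal depth of the two inner calls in the second. Quickhull on a nonempty finite list $P$ takes a left-most point $p$ and a right-most point $q$ of $P$ (ties arbitrary, but $p$ lowest and $q$ highest if all points lie on one vertical line), puts $S_1=\{u\in P:\widehat{rt}(p,u,q)\}$, $S_2=\{u\in P:\widehat{rt}(q,u,p)\}$, and returns $\hat H=\{p\}\cup$HULL$(S_1,p,\mathrm{reduce}_{p,q}(S_1),q)\cup\{q\}\cup$HULL$(S_2,q,\mathrm{reduce}_{q,p}(S_2),p)$;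 its depth $D$ is one more than the maximal depth of these two calls. *Forward error.* For a computed hull $\hat H$ of $P$ it is $d_M(CH(\hat H),CH(P))=d(CH(\hat H),CH(P))/M$, where $CH$ is the convex hull, $d$ the Hausdorff distance, and $M$ the maximal absolute value of the coordinates of the points of $P$ (for $M=0$ both hulls are $\{0\}$ and the error is $0$). **Theorem.** For each of the three evaluation orders: 1. $F_n=2\gamma_6\,c(n)$ is a reduction bound. 2. If a run of Quickhull on $P$ terminates with depth $D$, its forward error is at most $2DF_{|P|}$ for every reduction bound $F$ with $F_{|P|}\ge\gamma_6$ (this inequality is required only if $|P|\ge2$); it is also at most $2DF_{|P|}$ for $F_n=\gamma_6\,c(n)$. 3. The same holds for HULL: if all $u\in L$ satisfy $\widehat{rt}(p,u,q)$ and have $x$-coordinates between those of $p$ and $q$, and HULL$(L,p,\mathrm{reduce}_{p,q}(L),q)$ terminates with output $\hat H$ and depth $D$, then the forward error of $\hat H\cup\{p,q\}$ as the hull of $L\cup\{p,q\}$ is at most $2DF_{|L|}$, for the same choices of $F$ (with $|L|$ in place of $|P|$). 4. If $fl(-x)=-fl(x)$ for all $x$, then on every nonempty $P$ Quickhull has a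 terminating run, and every terminating run has $D\le|P|$. Consequently there is an absolute constant $C>0$ such that for $\epsilon\le1/12$ the forward error of every terminating run is at most $C\,D|P|\epsilon$, and at most $C\,|P|^2\epsilon$ if $fl(-x)=-fl(x)$ for all $x$, with sequential reduction; at most $C\,D\,(m+|P|/m)\,\epsilon$ with blocked reduction; and at most $C\,D\log|P|\,\epsilon$ with pairwise reduction. -/

import Mathlib

namespace FloatQuickhull

/-- Points of the plane; `u 0` and `u 1` are the `x`- and `y`-coordinate. -/
abbrev Pt := EuclideanSpace ℝ (Fin 2)

/-- The standard model of floating-point arithmetic with machine precision `ε`: the computed value of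
a primitive operation is `fl` of its exact value, with relative error at most `ε`. -/
def IsRounding (fl : ℝ → ℝ) (ε : ℝ) : Prop :=
  ∀ x : ℝ, |fl x - x| ≤ ε * |x|

/-- `γ₆ = 6ε / (1 - 6ε)`. -/
noncomputable def gamma6 (ε : ℝ) : ℝ := 6 * ε / (1 - 6 * ε)

/-- The orientation of `p, u, q`; positive iff `u` lies to the left of the oriented line `pq`. -/
def orient (p u q : Pt) : ℝ :=
  (p 0 - u 0) * (q 1 - u 1) - (p 1 - u 1) * (q 0 - u 0)

/-- The distance from `u` to the line through `p` and `q`. -/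
noncomputable def lineDist (u p q : Pt) : ℝ :=
  Metric.infDist u (line[ℝ, p, q] : Set Pt)

/-- The computed right-turn test,
`(p_x - u_x) (q_y - p_y) > (p_y - u_y) (q_x - p_x)` in floating point. -/
def rtHat (fl : ℝ → ℝ) (p u q : Pt) : Prop :=
  fl (fl (p 0 - u 0) * fl (q 1 - p 1)) > fl (fl (p 1 - u 1) * fl (q 0 - p 0))

/-- The computed test "`u` is farther from `pq` than `u'`",
`(q_y - p_y) (u_x - u'_x) < (q_x - p_x) (u_y - u'_y)` in floating point. -/
def frtHat (fl : ℝ → ℝ) (p q u u' : Pt) : Prop :=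
  fl (fl (q 1 - p 1) * fl (u 0 - u' 0)) < fl (fl (q 0 - p 0) * fl (u 1 - u' 1))

/-- The evaluation orders of the farthest-point reduction: one sequential pass, blocks of length `m`,
or recursive halving. -/
inductive Scheme where
  | simple : Scheme
  | blocked (m : ℕ+) : Scheme
  | pairwise : Scheme

/-- Sequential reduction, starting with the candidate `a`. -/
noncomputable def simpleReduce (far : Pt → Pt → Prop) (a : Pt) (L : List Pt) : Pt :=
  open Classical in L.foldl (fun uMax u => if far u uMax then u else uMax) a

/-- Sequential reduction of one block (the value `d` for an empty block is never used). -/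
noncomputable def blockReduce (far : Pt → Pt → Prop) (d : Pt) : List Pt → Pt
  | [] => d
  | a :: L => simpleReduce far a L

/-- Blocked reduction: the winner of every block of length `m` is compared with the candidate. -/
noncomputable def blockedReduce (far : Pt → Pt → Prop) (m : ℕ) (a : Pt) (L : List Pt) : Pt :=
  simpleReduce far a ((L.toChunks m).map (blockReduce far a))

/-- Reduction by recursive halving (the value `d` for an empty list is never used). -/
noncomputable def pairwiseReduce (far : Pt → Pt → Prop) (d : Pt) : List Pt → Pt
  | [] => d
  | [a] => a
  | a :: b :: L =>
    let u₁ := pairwiseReduce far d ((a :: b :: L).take ((a :: b :: L).length / 2))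
    let u₂ := pairwiseReduce far d ((a :: b :: L).drop ((a :: b :: L).length / 2))
    open Classical in if far u₁ u₂ then u₁ else u₂
termination_by L => L.length
decreasing_by all_goals (simp only [List.length_take, List.length_drop, List.length_cons]; omega)

/-- The computed farthest point from `pq` in a nonempty list. For the empty list a dummy value is
returned, which the algorithm never looks at. -/
noncomputable def farthest (fl : ℝ → ℝ) (s : Scheme) (p q : Pt) : List Pt → Pt
  | [] => p
  | a :: L =>
    match s with
    | .simple => simpleReduce (frtHat fl p q) a L
    | .blocked m => blockedReduce (frtHat fl p q) m a L
    | .pairwise => pairwiseReduce (frtHat fl p q) a (a :: L)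

/-- The points of `L` that are computed to be to the left of `pq`. -/
noncomputable def leftOf (fl : ℝ → ℝ) (p q : Pt) (L : List Pt) : List Pt :=
  open Classical in L.filter (fun u => decide (rtHat fl p u q))

/-- `HullRun fl s L p r q H D`: the floating-point call `HULL(L, p, r, q)` terminates with output `H`
and recursion depth `D` (a call that makes no recursive call has depth `0`). -/
inductive HullRun (fl : ℝ → ℝ) (s : Scheme) :
    List Pt → Pt → Pt → Pt → List Pt → ℕ → Prop
  | base (L : List Pt) (p r q : Pt) : L.length ≤ 1 → HullRun fl s L p r q L 0
  | step (L : List Pt) (p r q : Pt) (H₁ H₂ : List Pt) (D₁ D₂ : ℕ) : 1 < L.length →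
      HullRun fl s (leftOf fl p r L) p (farthest fl s p r (leftOf fl p r L)) r H₁ D₁ →
      HullRun fl s (leftOf fl r q L) r (farthest fl s r q (leftOf fl r q L)) q H₂ D₂ →
      HullRun fl s L p r q ([p] ++ H₁ ++ [r] ++ H₂ ++ [q]) (max D₁ D₂ + 1)

/-- `p` is a left-most and `q` a right-most point of `P`. Ties are broken arbitrarily, except that for
points on one vertical line `p` is the lowest and `q` the highest. -/
def IsExtremePair (P : List Pt) (p q : Pt) : Prop :=
  p ∈ P ∧ q ∈ P ∧ (∀ u ∈ P, p 0 ≤ u 0 ∧ u 0 ≤ q 0) ∧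
    (p 0 = q 0 → ∀ u ∈ P, p 1 ≤ u 1 ∧ u 1 ≤ q 1)

/-- Floating-point Quickhull on `P` terminates with output `H` and recursion depth `D`; its first step
has the structure of a call of `HULL` and counts as one level. -/
def QuickhullRun (fl : ℝ → ℝ) (s : Scheme) (P H : List Pt) (D : ℕ) : Prop :=
  ∃ (p q : Pt) (H₁ H₂ : List Pt) (D₁ D₂ : ℕ), IsExtremePair P p q ∧
    HullRun fl s (leftOf fl p q P) p (farthest fl s p q (leftOf fl p q P)) q H₁ D₁ ∧
    HullRun fl s (leftOf fl q p P) q (farthest fl s q p (leftOf fl q p P)) p H₂ D₂ ∧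
    H = [p] ++ H₁ ++ [q] ++ H₂ ∧ D = max D₁ D₂ + 1

/-- `M`: the maximum absolute value of the coordinates of the points of `P`. -/
noncomputable def maxCoord (P : List Pt) : ℝ :=
  (P.map fun u => max |u 0| |u 1|).foldr max 0

/-- The convex hull of a finite list of points. -/
def CH (P : List Pt) : Set Pt := convexHull ℝ {u | u ∈ P}

/-- The forward error `d_M(CH(H), CH(P)) = d(CH(H), CH(P)) / M` of the computed hull `H` of `P`, where
`d` is the Hausdorff distance and `M` belongs to the input `P`. -/
noncomputable def forwardError (H P : List Pt) : ℝ :=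
  Metric.hausdorffDist (CH H) (CH P) / maxCoord P

/-- `F n` bounds the scaled error `(d(r, pq) - d(r̂, pq)) / M` of the computed farthest point `r̂` among
`n` points to the left of `pq`. -/
def IsReductionBound (fl : ℝ → ℝ) (s : Scheme) (F : ℕ → ℝ) : Prop :=
  ∀ (L : List Pt) (p q : Pt), L ≠ [] → p ≠ q → (∀ u ∈ L, 0 < orient p u q) →
    ∀ r ∈ L, (lineDist r p q - lineDist (farthest fl s p q L) p q) / maxCoord (p :: q :: L) ≤
      F L.length

/-- The number of comparisons through which an error can propagate in a reduction of `n` points: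
`n - 1`, `m + n / m` and `⌈log₂ n⌉` for the three evaluation orders. -/
noncomputable def chain : Scheme → ℕ → ℝ
  | .simple, n => ((n - 1 : ℕ) : ℝ)
  | .blocked m, n => (m : ℝ) + (n : ℝ) / (m : ℝ)
  | .pairwise, n => (Nat.clog 2 n : ℝ)

end FloatQuickhull

/-!
Two computed products compare wrongly only if the exact products differ by at most `γ₆` times the
smaller of their absolute values, so each of the two computed tests decides the sign of an exact
orientation up to such an additive error. A wrong decision of `frtHat` costs at most `2γ₆M` in
distance from `pq`, and these losses add up along the chain of comparisons.

For the hull, fix an input point `u` and follow it through the recursive calls whose vertical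
strip contains it. As `u` was computed to be to the left of the base edge of such a call, the
vertical line through `u` meets that edge at most `2γ₆M` beyond `u`. Unless `u` is output in the
end, it is not computed to be to the left of the new edge over its strip at some call, and the
vertical line meets that edge at most `2γ₆M` before `u`. A point of the computed hull between
these two is within `2γ₆M` of `u`. The error is thus at most `2γ₆`, whatever the depth.
-/

namespace FloatQuickhull

/-! ### Rounding errors -/

section Rounding

variable {fl : ℝ → ℝ} {ε : ℝ}

theorem IsRounding.nonneg (h : IsRounding fl ε) : 0 ≤ ε := by
  simpa using (abs_nonneg _).trans (h 1)

theorem IsRounding.map_zero (h : IsRounding fl ε) : fl 0 = 0 := by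
  simpa using h 0

theorem IsRounding.exists_eq_mul (h : IsRounding fl ε) (x : ℝ) :
    ∃ κ, 1 - ε ≤ κ ∧ κ ≤ 1 + ε ∧ fl x = κ * x := by
  rcases eq_or_ne x 0 with rfl | hx
  · exact ⟨1, by linarith [h.nonneg], by linarith [h.nonneg], by simp [h.map_zero]⟩
  · have hrel : |fl x / x - 1| ≤ ε := by
      rw [div_sub_one hx, abs_div, div_le_iff₀ (abs_pos.2 hx)]
      exact h x
    obtain ⟨hlower, hupper⟩ := abs_le.1 hrel
    exact ⟨fl x / x, by linarith, by linarith, by field_simp⟩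

theorem IsRounding.exists_map_mul_map_eq_mul (h : IsRounding fl ε) (hε : ε ≤ 1) (x y : ℝ) :
    ∃ κ, (1 - ε) ^ 3 ≤ κ ∧ κ ≤ (1 + ε) ^ 3 ∧ fl (fl x * fl y) = κ * (x * y) := by
  obtain ⟨a, ha, ha', hx⟩ := h.exists_eq_mul x
  obtain ⟨b, hb, hb', hy⟩ := h.exists_eq_mul y
  obtain ⟨c, hc, hc', hxy⟩ := h.exists_eq_mul (fl x * fl y)
  have hε₀ : 0 ≤ 1 - ε := by linarith
  have hca : 0 ≤ c * a := mul_nonneg (hε₀.trans hc) (hε₀.trans ha)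
  refine ⟨c * a * b, ?_, ?_, by rw [hxy, hx, hy]; ring⟩
  · calc (1 - ε) ^ 3 = (1 - ε) * (1 - ε) * (1 - ε) := by ring
      _ ≤ c * a * b := by gcongr; exact hε₀.trans hc
  · have hε₁ : 0 ≤ 1 + ε := by linarith
    calc c * a * b ≤ (1 + ε) * (1 + ε) * (1 + ε) := by gcongr <;> exact hε₀.trans ‹_›
      _ = (1 + ε) ^ 3 := by ring

theorem gamma6_nonneg (hε : 0 ≤ ε) (hε' : 6 * ε < 1) : 0 ≤ gamma6 ε :=
  div_nonneg (by linarith) (by linarith)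

theorem gamma6_le (hε : 0 ≤ ε) (hε' : 12 * ε ≤ 1) : gamma6 ε ≤ 12 * ε := by
  rw [gamma6, div_le_iff₀ (by linarith)]
  nlinarith

theorem one_add_gamma6 (hε : 6 * ε ≠ 1) : 1 + gamma6 ε = 1 / (1 - 6 * ε) := by
  have : 1 - 6 * ε ≠ 0 := sub_ne_zero.2 hε.symm
  unfold gamma6
  field_simp
  ring

theorem one_add_pow_three_le (hε : 0 ≤ ε) (hε' : 6 * ε < 1) :
    (1 + ε) ^ 3 ≤ (1 + gamma6 ε) * (1 - ε) ^ 3 := by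
  have hbernoulli : 1 - 6 * ε ≤ (1 - ε) ^ 6 := by
    have := one_add_mul_le_pow (a := -ε) (by linarith) 6
    push_cast at this
    linarith
  have hsq : (1 - ε ^ 2) ^ 3 ≤ 1 := pow_le_one₀ (by nlinarith) (by nlinarith)
  have hpos : 0 ≤ 1 - ε := by linarith
  rw [one_add_gamma6 hε'.ne, div_mul_eq_mul_div, le_div_iff₀ (by linarith), one_mul]
  calc (1 + ε) ^ 3 * (1 - 6 * ε) ≤ (1 + ε) ^ 3 * (1 - ε) ^ 6 := by gcongr
    _ = (1 - ε ^ 2) ^ 3 * (1 - ε) ^ 3 := by ring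
    _ ≤ (1 - ε) ^ 3 := mul_le_of_le_one_left (by positivity) hsq

theorem sub_le_mul_min_abs_of_mul_le_mul {l γ κ κ' a b : ℝ} (hl : 0 < l) (hγ : 0 ≤ γ)
    (hκ : l ≤ κ) (hκγ : κ ≤ (1 + γ) * l) (hκ' : l ≤ κ') (hκγ' : κ' ≤ (1 + γ) * l)
    (h : κ * a ≤ κ' * b) : a - b ≤ γ * min |a| |b| := by
  rcases le_or_gt a b with hab | hab
  · exact (sub_nonpos.2 hab).trans (by positivity)
  rcases le_or_gt 0 b with hb | hb
  · have hba : a ≤ (1 + γ) * b := by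
      refine le_of_mul_le_mul_left ?_ hl
      calc l * a ≤ κ * a := mul_le_mul_of_nonneg_right hκ (hb.trans hab.le)
        _ ≤ κ' * b := h
        _ ≤ (1 + γ) * l * b := mul_le_mul_of_nonneg_right hκγ' hb
        _ = l * ((1 + γ) * b) := by ring
    rw [abs_of_pos (hb.trans_lt hab), abs_of_nonneg hb, min_eq_right hab.le]
    linarith
  · have ha : a < 0 :=
      neg_of_mul_neg_right (h.trans_lt (mul_neg_of_pos_of_neg (hl.trans_le hκ') hb))
        (hl.le.trans hκ)
    have hab' : -b ≤ (1 + γ) * -a := by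
      refine le_of_mul_le_mul_left ?_ hl
      calc l * -b ≤ κ' * -b := mul_le_mul_of_nonneg_right hκ' (by linarith)
        _ ≤ κ * -a := by linarith
        _ ≤ (1 + γ) * l * -a := mul_le_mul_of_nonneg_right hκγ (by linarith)
        _ = l * ((1 + γ) * -a) := by ring
    rw [abs_of_neg ha, abs_of_neg hb, min_eq_left (by linarith)]
    linarith

theorem IsRounding.sub_le_of_map_mul_le (h : IsRounding fl ε) (hε : 6 * ε < 1) {x y x' y' : ℝ}
    (hle : fl (fl x * fl y) ≤ fl (fl x' * fl y')) :
    x * y - x' * y' ≤ gamma6 ε * min |x * y| |x' * y'| := by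
  have hε₀ := h.nonneg
  have hγ := one_add_pow_three_le hε₀ hε
  obtain ⟨κ, hκ, hκγ, hxy⟩ := h.exists_map_mul_map_eq_mul (by linarith) x y
  obtain ⟨κ', hκ', hκγ', hxy'⟩ := h.exists_map_mul_map_eq_mul (by linarith) x' y'
  exact sub_le_mul_min_abs_of_mul_le_mul (pow_pos (by linarith) 3) (gamma6_nonneg hε₀ hε)
    hκ (hκγ.trans hγ) hκ' (hκγ'.trans hγ) (hxy ▸ hxy' ▸ hle)

end Rounding

/-! ### Reduction by approximate comparisons -/

/-- On `A`, the comparison `far` decides which of two values of `f` is larger, up to an additive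
error `e`; this is all that the analysis of the reductions needs to know about `frtHat`. -/
def ComparesUpTo {α : Type*} (far : α → α → Prop) (f : α → ℝ) (e : ℝ) (A : Set α) : Prop :=
  ∀ u ∈ A, ∀ v ∈ A, (far u v → f v ≤ f u + e) ∧ (¬ far u v → f u ≤ f v + e)

theorem ComparesUpTo.max_le_ite {α : Type*} {far : α → α → Prop} {f : α → ℝ} {e : ℝ} {A : Set α}
    (hc : ComparesUpTo far f e A) (he : 0 ≤ e) {u v : α} (hu : u ∈ A) (hv : v ∈ A)
    [Decidable (far u v)] : max (f u) (f v) ≤ f (if far u v then u else v) + e := by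
  have huv := hc u hu v hv
  split_ifs with hfar
  · exact max_le (by linarith) (huv.1 hfar)
  · exact max_le (huv.2 hfar) (by linarith)

section Reduction

variable {far : Pt → Pt → Prop} {f : Pt → ℝ} {e : ℝ} {A : Set Pt}

theorem simpleReduce_mem (far : Pt → Pt → Prop) (a : Pt) (L : List Pt) :
    simpleReduce far a L ∈ a :: L := by
  classical
  refine List.foldlRecOn L _ List.mem_cons_self fun b hb u hu => ?_
  split_ifs
  exacts [List.mem_cons_of_mem a hu, hb]

theorem le_simpleReduce_add (hc : ComparesUpTo far f e A) (he : 0 ≤ e) {a : Pt} {L : List Pt}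
    (hA : ∀ u ∈ a :: L, u ∈ A) {r : Pt} (hr : r ∈ a :: L) :
    f r ≤ f (simpleReduce far a L) + e * L.length := by
  classical
  induction L generalizing a r with
  | nil => simp_all [simpleReduce]
  | cons b L ih =>
    obtain ⟨ha, hb, hL⟩ : a ∈ A ∧ b ∈ A ∧ ∀ u ∈ L, u ∈ A := by simpa using hA
    set c := if far b a then b else a with hcdef
    have hcA : c ∈ A := by rw [hcdef]; split_ifs <;> assumption
    have hstep : max (f b) (f a) ≤ f c + e := hc.max_le_ite he hb ha
    have hreduce : simpleReduce far a (b :: L) = simpleReduce far c L := by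
      rw [simpleReduce, List.foldl_cons, hcdef]; congr
    have hind {r : Pt} (hr : r ∈ c :: L) := ih (List.forall_mem_cons.2 ⟨hcA, hL⟩) hr
    have hwin := hind List.mem_cons_self
    rw [hreduce, List.length_cons, Nat.cast_succ]
    rcases List.mem_cons.1 hr with rfl | hr
    · linarith [le_max_right (f b) (f r)]
    rcases List.mem_cons.1 hr with rfl | hr
    · linarith [le_max_left (f r) (f a)]
    · linarith [hind (List.mem_cons_of_mem c hr)]

theorem toChunks_go_eq {α : Type*} {n : ℕ} (hn : n ≠ 0) (xs : List α) (acc₁ : Array α)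
    (acc₂ : Array (List α)) (h : acc₁.size ≤ n) :
    List.toChunks.go n xs acc₁ acc₂ = acc₂.toList ++ (acc₁.toList ++ xs.take (n - acc₁.size)) ::
      (xs.drop (n - acc₁.size)).toChunks n := by
  obtain ⟨k, rfl⟩ := Nat.exists_eq_succ_of_ne_zero hn
  induction xs generalizing acc₁ acc₂ with
  | nil => simp [List.toChunks.go, List.toChunks]
  | cons x xs ih =>
    rw [List.toChunks.go]
    split_ifs with hsize
    · have hsize : acc₁.size = k + 1 := by simpa using hsize
      rw [ih _ _ (by simp)]
      simp [hsize, List.toChunks, ih #[x] #[]]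
    · have hsize : acc₁.size < k + 1 := lt_of_le_of_ne h (by simpa using hsize)
      rw [ih _ _ (by simpa using hsize)]
      obtain ⟨j, hj⟩ : ∃ j, k + 1 - acc₁.size = j + 1 := ⟨k - acc₁.size, by lia⟩
      simp [hj, show k - acc₁.size = j by lia]

theorem toChunks_eq_take_cons {α : Type*} {n : ℕ} (hn : n ≠ 0) {xs : List α} (hxs : xs ≠ []) :
    xs.toChunks n = xs.take n :: (xs.drop n).toChunks n := by
  obtain ⟨x, xs, rfl⟩ := List.exists_cons_of_ne_nil hxs
  obtain ⟨k, rfl⟩ := Nat.exists_eq_succ_of_ne_zero hn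
  rw [List.toChunks, toChunks_go_eq hn _ _ _ (by simp)]
  · simp
  · simp

@[elab_as_elim]
theorem toChunks_induction {α : Type*} {n : ℕ} (hn : n ≠ 0) {motive : List α → List (List α) → Prop}
    (nil : motive [] [])
    (cons : ∀ xs, xs ≠ [] → motive (xs.drop n) ((xs.drop n).toChunks n) →
      motive xs (xs.take n :: (xs.drop n).toChunks n)) (xs : List α) :
    motive xs (xs.toChunks n) := by
  rcases eq_or_ne xs [] with rfl | hxs
  · simpa only [List.toChunks] using nil
  · rw [toChunks_eq_take_cons hn hxs]
    exact cons xs hxs (toChunks_induction hn nil cons (xs.drop n))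
termination_by xs.length
decreasing_by
  have := List.length_pos_iff.2 hxs
  rw [List.length_drop]
  lia

theorem flatten_toChunks {α : Type*} {n : ℕ} (hn : n ≠ 0) (xs : List α) :
    (xs.toChunks n).flatten = xs := by
  induction xs using toChunks_induction hn with
  | nil => rfl
  | cons xs _ ih => rw [List.flatten_cons, ih, List.take_append_drop]

theorem ne_nil_of_mem_toChunks {α : Type*} {n : ℕ} (hn : n ≠ 0) {xs c : List α}
    (hc : c ∈ xs.toChunks n) : c ≠ [] := by
  induction xs using toChunks_induction hn with
  | nil => simp at hc
  | cons xs hxs ih =>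
    rcases List.mem_cons.1 hc with rfl | hc
    · simp [List.take_eq_nil_iff, hn, hxs]
    · exact ih hc

theorem length_le_of_mem_toChunks {α : Type*} {n : ℕ} (hn : n ≠ 0) {xs c : List α}
    (hc : c ∈ xs.toChunks n) : c.length ≤ n := by
  induction xs using toChunks_induction hn with
  | nil => simp at hc
  | cons xs _ ih =>
    rcases List.mem_cons.1 hc with rfl | hc
    · exact List.length_take_le n xs
    · exact ih hc

theorem length_toChunks_mul_lt {α : Type*} {n : ℕ} (hn : n ≠ 0) (xs : List α) :
    (xs.toChunks n).length * n < xs.length + n := by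
  induction xs using toChunks_induction hn with
  | nil => simpa using hn.bot_lt
  | cons xs hxs ih =>
    rw [List.length_cons, Nat.succ_mul, Nat.add_lt_add_iff_right]
    rcases le_or_gt xs.length n with hle | hlt
    · simpa [List.drop_eq_nil_of_le hle, List.toChunks] using List.length_pos_iff.2 hxs
    · rwa [List.length_drop, Nat.sub_add_cancel hlt.le] at ih

theorem blockReduce_mem (far : Pt → Pt → Prop) (d : Pt) {c : List Pt} (hc : c ≠ []) :
    blockReduce far d c ∈ c := by
  obtain ⟨a, c, rfl⟩ := List.exists_cons_of_ne_nil hc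
  exact simpleReduce_mem far a c

theorem le_blockReduce_add (hc : ComparesUpTo far f e A) (he : 0 ≤ e) (d : Pt) {c : List Pt}
    (hA : ∀ u ∈ c, u ∈ A) {r : Pt} (hr : r ∈ c) :
    f r ≤ f (blockReduce far d c) + e * (c.length - 1) := by
  obtain ⟨a, c, rfl⟩ := List.exists_cons_of_ne_nil (List.ne_nil_of_mem hr)
  simpa [blockReduce] using le_simpleReduce_add hc he hA hr

theorem mem_of_mem_map_blockReduce {far : Pt → Pt → Prop} {n : ℕ} (hn : n ≠ 0) {d u : Pt}
    {L : List Pt} (hu : u ∈ (L.toChunks n).map (blockReduce far d)) : u ∈ L := by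
  obtain ⟨c, hc, rfl⟩ := List.mem_map.1 hu
  rw [← flatten_toChunks hn L]
  exact List.mem_flatten_of_mem hc (blockReduce_mem far d (ne_nil_of_mem_toChunks hn hc))

theorem blockedReduce_mem (far : Pt → Pt → Prop) {n : ℕ} (hn : n ≠ 0) (a : Pt) (L : List Pt) :
    blockedReduce far n a L ∈ a :: L :=
  List.mem_cons.2 <| (List.mem_cons.1 (simpleReduce_mem far a _)).imp_right
    (mem_of_mem_map_blockReduce hn)

theorem le_blockedReduce_add (hc : ComparesUpTo far f e A) (he : 0 ≤ e) {n : ℕ} (hn : n ≠ 0)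
    {a : Pt} {L : List Pt} (hA : ∀ u ∈ a :: L, u ∈ A) {r : Pt} (hr : r ∈ a :: L) :
    f r ≤ f (blockedReduce far n a L) + e * (n + (a :: L).length / n) := by
  set winners := (L.toChunks n).map (blockReduce far a) with hwinners
  have hn₁ : (1 : ℝ) ≤ n := by exact_mod_cast Nat.one_le_iff_ne_zero.2 hn
  obtain ⟨ha, hL⟩ := List.forall_mem_cons.1 hA
  have hcount : (winners.length : ℝ) ≤ 1 + (a :: L).length / n := by
    have hlt : ((L.toChunks n).length : ℝ) * n < L.length + n := by
      exact_mod_cast length_toChunks_mul_lt hn L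
    rw [← sub_le_iff_le_add', le_div_iff₀ (by linarith), sub_one_mul, hwinners, List.length_map,
      List.length_cons, Nat.cast_succ]
    linarith
  have houter {w : Pt} (hw : w ∈ a :: winners) :
      f w ≤ f (blockedReduce far n a L) + e * (1 + (a :: L).length / n) :=
    (le_simpleReduce_add hc he
      (List.forall_mem_cons.2 ⟨ha, fun u hu => hL u (mem_of_mem_map_blockReduce hn hu)⟩) hw).trans
      (by gcongr; rfl)
  rcases List.mem_cons.1 hr with rfl | hr
  · exact (houter List.mem_cons_self).trans (by gcongr)
  · rw [← flatten_toChunks hn L] at hr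
    obtain ⟨c, hcL, hrc⟩ := List.mem_flatten.1 hr
    have hwinner := houter (List.mem_cons_of_mem a (List.mem_map_of_mem hcL))
    have hinner : f r ≤ f (blockReduce far a c) + e * (n - 1) := by
      refine (le_blockReduce_add hc he a (fun u hu => hL u ?_) hrc).trans ?_
      · exact flatten_toChunks hn L ▸ List.mem_flatten_of_mem hcL hu
      · gcongr
        exact length_le_of_mem_toChunks hn hcL
    linarith

open Classical in
@[elab_as_elim]
theorem pairwiseReduce_induction (far : Pt → Pt → Prop) (d : Pt) {motive : List Pt → Pt → Prop}
    (nil : motive [] d) (singleton : ∀ a, motive [a] a)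
    (append : ∀ L₁ L₂, L₁ ≠ [] → L₂ ≠ [] → L₁.length ≤ L₂.length → L₂.length ≤ L₁.length + 1 →
      motive L₁ (pairwiseReduce far d L₁) → motive L₂ (pairwiseReduce far d L₂) →
      motive (L₁ ++ L₂) (if far (pairwiseReduce far d L₁) (pairwiseReduce far d L₂) then
        pairwiseReduce far d L₁ else pairwiseReduce far d L₂))
    (L : List Pt) : motive L (pairwiseReduce far d L) :=
  match L with
  | [] => by simpa only [pairwiseReduce] using nil
  | [a] => by simpa only [pairwiseReduce] using singleton a
  | a :: b :: L => by
    rw [pairwiseReduce]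
    have hlen : 2 ≤ (a :: b :: L).length := by simp
    generalize a :: b :: L = L at *
    have htake : (L.take (L.length / 2)).length = L.length / 2 := List.length_take_of_le (by lia)
    have hdrop : (L.drop (L.length / 2)).length = L.length - L.length / 2 := List.length_drop
    have htake_ne : L.take (L.length / 2) ≠ [] := List.ne_nil_of_length_pos (by lia)
    have hdrop_ne : L.drop (L.length / 2) ≠ [] := List.ne_nil_of_length_pos (by lia)
    have := append _ _ htake_ne hdrop_ne (by lia) (by lia)
      (pairwiseReduce_induction far d nil singleton append (L.take (L.length / 2)))
      (pairwiseReduce_induction far d nil singleton append (L.drop (L.length / 2)))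
    rwa [List.take_append_drop] at this
termination_by L.length
decreasing_by all_goals lia

theorem pairwiseReduce_mem (far : Pt → Pt → Prop) (d : Pt) {L : List Pt} (hL : L ≠ []) :
    pairwiseReduce far d L ∈ L := by
  induction L using pairwiseReduce_induction far d with
  | nil => exact absurd rfl hL
  | singleton a => exact List.mem_cons_self
  | append L₁ L₂ h₁ h₂ _ _ ih₁ ih₂ =>
    split_ifs
    exacts [List.mem_append_left L₂ (ih₁ h₁), List.mem_append_right L₁ (ih₂ h₂)]

theorem clog_two_length_append {α : Type*} {L₁ L₂ : List α} (h₁ : L₁ ≠ [])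
    (h₁₂ : L₁.length ≤ L₂.length) (h₂₁ : L₂.length ≤ L₁.length + 1) :
    Nat.clog 2 (L₁ ++ L₂).length = Nat.clog 2 L₂.length + 1 := by
  have := List.length_pos_iff.2 h₁
  rw [List.length_append, Nat.clog_of_two_le one_lt_two (by lia),
    show (L₁.length + L₂.length + 2 - 1) / 2 = L₂.length by lia]

theorem le_pairwiseReduce_add (hc : ComparesUpTo far f e A) (he : 0 ≤ e) (d : Pt) {L : List Pt}
    (hA : ∀ u ∈ L, u ∈ A) {r : Pt} (hr : r ∈ L) :
    f r ≤ f (pairwiseReduce far d L) + e * Nat.clog 2 L.length := by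
  classical
  induction L using pairwiseReduce_induction far d with
  | nil => simp at hr
  | singleton a => simp_all
  | append L₁ L₂ h₁ h₂ h₁₂ h₂₁ ih₁ ih₂ =>
    obtain ⟨hA₁, hA₂⟩ := List.forall_mem_append.1 hA
    have hcmp := hc.max_le_ite he (hA₁ _ (pairwiseReduce_mem far d h₁))
      (hA₂ _ (pairwiseReduce_mem far d h₂))
    have hclog : e * Nat.clog 2 L₁.length ≤ e * Nat.clog 2 L₂.length := by gcongr
    rw [clog_two_length_append h₁ h₁₂ h₂₁, Nat.cast_succ, mul_add_one]
    rcases List.mem_append.1 hr with hr | hr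
    · linarith [ih₁ hA₁ hr, (max_le_iff.1 hcmp).1]
    · linarith [ih₂ hA₂ hr, (max_le_iff.1 hcmp).2]

theorem farthest_mem (fl : ℝ → ℝ) (s : Scheme) (p q : Pt) {L : List Pt} (hL : L ≠ []) :
    farthest fl s p q L ∈ L := by
  obtain ⟨a, L, rfl⟩ := List.exists_cons_of_ne_nil hL
  cases s with
  | simple => exact simpleReduce_mem _ a L
  | blocked m => exact blockedReduce_mem _ m.ne_zero a L
  | pairwise => exact pairwiseReduce_mem _ a hL

theorem farthest_mem_cons (fl : ℝ → ℝ) (s : Scheme) (p q : Pt) (L : List Pt) :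
    farthest fl s p q L ∈ p :: L := by
  rcases eq_or_ne L [] with rfl | hL
  · exact List.mem_cons_self
  · exact List.mem_cons_of_mem p (farthest_mem fl s p q hL)

theorem le_farthest_add {fl : ℝ → ℝ} {s : Scheme} {p q : Pt}
    (hc : ComparesUpTo (frtHat fl p q) f e A) (he : 0 ≤ e) {L : List Pt} (hA : ∀ u ∈ L, u ∈ A)
    {r : Pt} (hr : r ∈ L) : f r ≤ f (farthest fl s p q L) + e * chain s L.length := by
  obtain ⟨a, L, rfl⟩ := List.exists_cons_of_ne_nil (List.ne_nil_of_mem hr)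
  cases s with
  | simple => exact le_simpleReduce_add hc he hA hr
  | blocked m => exact le_blockedReduce_add hc he m.ne_zero hA hr
  | pairwise => exact le_pairwiseReduce_add hc he a hA hr

end Reduction

/-! ### Distance to a line -/

theorem orient_eq (p u q : Pt) :
    orient p u q = (p 0 - u 0) * (q 1 - p 1) - (p 1 - u 1) * (q 0 - p 0) := by
  unfold orient
  ring

theorem dist_sq_eq (p q : Pt) : dist p q ^ 2 = (p 0 - q 0) ^ 2 + (p 1 - q 1) ^ 2 := by
  simp [EuclideanSpace.dist_sq_eq, Fin.sum_univ_two, Real.dist_eq]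

theorem abs_sub_apply_le_dist (p q : Pt) (i : Fin 2) : |p i - q i| ≤ dist p q := by
  simpa [Real.norm_eq_abs, dist_eq_norm] using PiLp.norm_apply_le (p - q) i

theorem lineMap_apply_coord (p q : Pt) (t : ℝ) (i : Fin 2) :
    AffineMap.lineMap p q t i = t * (q i - p i) + p i := by
  simp [AffineMap.lineMap_apply]

theorem orient_sq_add_sq_eq (u p q : Pt) (t : ℝ) :
    orient p u q ^ 2 + ((u 0 - p 0) * (q 0 - p 0) + (u 1 - p 1) * (q 1 - p 1) -
      t * dist p q ^ 2) ^ 2 = dist u (AffineMap.lineMap p q t) ^ 2 * dist p q ^ 2 := by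
  simp only [orient_eq, dist_sq_eq, lineMap_apply_coord]
  ring

theorem lineDist_eq {p q : Pt} (hpq : p ≠ q) (u : Pt) :
    lineDist u p q = |orient p u q| / dist p q := by
  have hd : 0 < dist p q := dist_pos.2 hpq
  have hmem (t : ℝ) : AffineMap.lineMap p q t ∈ line[ℝ, p, q] :=
    AffineMap.lineMap_mem_affineSpan_pair t p q
  apply le_antisymm
  · set t := ((u 0 - p 0) * (q 0 - p 0) + (u 1 - p 1) * (q 1 - p 1)) / dist p q ^ 2
    have hfoot : (u 0 - p 0) * (q 0 - p 0) + (u 1 - p 1) * (q 1 - p 1) - t * dist p q ^ 2 = 0 := by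
      rw [div_mul_cancel₀ _ (by positivity), sub_self]
    have hsq := orient_sq_add_sq_eq u p q t
    rw [hfoot, zero_pow two_ne_zero, add_zero, ← mul_pow] at hsq
    refine (Metric.infDist_le_dist_of_mem (hmem t)).trans ?_
    rw [le_div_iff₀ hd]
    exact (le_abs_self _).trans (sq_le_sq.1 hsq.ge)
  · refine (Metric.le_infDist ⟨_, hmem 0⟩).2 fun v hv => ?_
    obtain ⟨t, rfl⟩ := mem_affineSpan_pair_iff_exists_lineMap_eq.1 hv
    rw [div_le_iff₀ hd]
    refine abs_le_of_sq_le_sq ?_ (by positivity)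
    rw [mul_pow, ← orient_sq_add_sq_eq]
    exact le_add_of_nonneg_right (sq_nonneg _)

theorem abs_apply_le_maxCoord {P : List Pt} {u : Pt} (hu : u ∈ P) (i : Fin 2) :
    |u i| ≤ maxCoord P := by
  induction P with
  | nil => simp at hu
  | cons a P ih =>
    change _ ≤ max (max |a 0| |a 1|) (maxCoord P)
    rcases List.mem_cons.1 hu with rfl | hu
    · refine le_max_of_le_left ?_
      fin_cases i
      exacts [le_max_left _ _, le_max_right _ _]
    · exact le_max_of_le_right (ih hu)

theorem maxCoord_nonneg (P : List Pt) : 0 ≤ maxCoord P := by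
  cases P with
  | nil => rfl
  | cons a P => exact (abs_nonneg _).trans (abs_apply_le_maxCoord List.mem_cons_self 0)

theorem eq_of_maxCoord_eq_zero {P : List Pt} (hP : maxCoord P = 0) {p q : Pt} (hp : p ∈ P)
    (hq : q ∈ P) : p = q := by
  have hzero {u : Pt} (hu : u ∈ P) (i : Fin 2) : u i = 0 :=
    abs_nonpos_iff.1 ((abs_apply_le_maxCoord hu i).trans_eq hP)
  ext i
  rw [hzero hp, hzero hq]

theorem abs_sub_apply_le_two_mul_maxCoord {P : List Pt} {u v : Pt} (hu : u ∈ P) (hv : v ∈ P)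
    (i : Fin 2) : |u i - v i| ≤ 2 * maxCoord P := by
  linarith [abs_sub (u i) (v i), abs_apply_le_maxCoord hu i, abs_apply_le_maxCoord hv i]

theorem frtHat_comparesUpTo {fl : ℝ → ℝ} {ε : ℝ} (h : IsRounding fl ε) (hε : 6 * ε < 1) (p q : Pt)
    (P : List Pt) :
    ComparesUpTo (frtHat fl p q) (fun u => orient p u q)
      (gamma6 ε * (dist p q * (2 * maxCoord P))) {u | u ∈ P} := by
  intro u hu v hv
  have hγ := gamma6_nonneg h.nonneg hε
  have hle : |(q 0 - p 0) * (u 1 - v 1)| ≤ dist p q * (2 * maxCoord P) := by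
    rw [abs_mul, dist_comm]
    gcongr
    exacts [abs_sub_apply_le_dist q p 0, abs_sub_apply_le_two_mul_maxCoord hu hv 1]
  have horient : orient p u q - orient p v q =
      (q 0 - p 0) * (u 1 - v 1) - (q 1 - p 1) * (u 0 - v 0) := by
    simp only [orient_eq]
    ring
  have hbound {a : ℝ} (ha : a ≤ |(q 0 - p 0) * (u 1 - v 1)|) :
      gamma6 ε * a ≤ gamma6 ε * (dist p q * (2 * maxCoord P)) :=
    mul_le_mul_of_nonneg_left (ha.trans hle) hγ
  refine ⟨fun hfar => ?_, fun hfar => ?_⟩ <;> beta_reduce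
  · linarith [(h.sub_le_of_map_mul_le hε hfar.le).trans (hbound (min_le_right _ _))]
  · linarith [(h.sub_le_of_map_mul_le hε (not_lt.1 hfar)).trans (hbound (min_le_left _ _))]

theorem isReductionBound_gamma6 {fl : ℝ → ℝ} {ε : ℝ} (h : IsRounding fl ε) (hε : 6 * ε < 1)
    (s : Scheme) : IsReductionBound fl s (fun n => 2 * gamma6 ε * chain s n) := by
  intro L p q hL hpq hleft r hr
  have hM : 0 < maxCoord (p :: q :: L) :=
    (maxCoord_nonneg _).lt_of_ne' fun hM => hpq (eq_of_maxCoord_eq_zero hM (by simp) (by simp))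
  have hγ := gamma6_nonneg h.nonneg hε
  have herr := le_farthest_add (s := s) (frtHat_comparesUpTo h hε p q (p :: q :: L))
    (by positivity) (fun u hu => List.mem_cons_of_mem p (List.mem_cons_of_mem q hu)) hr
  rw [div_le_iff₀ hM, lineDist_eq hpq, lineDist_eq hpq, abs_of_pos (hleft r hr),
    abs_of_pos (hleft _ (farthest_mem fl s p q hL)), ← sub_div, div_le_iff₀ (dist_pos.2 hpq)]
  linarith

/-! ### Vertical distance to the computed hull -/

theorem exists_mem_segment_vertical {p q u : Pt} (hu : u 0 ∈ Set.uIcc (p 0) (q 0)) :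
    ∃ z ∈ segment ℝ p q, z 0 = u 0 ∧ orient p u q = (q 0 - p 0) * (u 1 - z 1) := by
  rw [← segment_eq_uIcc] at hu
  obtain ⟨a, b, ha, hb, hab, hu⟩ := hu
  simp only [smul_eq_mul] at hu
  refine ⟨a • p + b • q, ⟨a, b, ha, hb, hab, rfl⟩, by simpa using hu, ?_⟩
  simp only [orient_eq, PiLp.add_apply, PiLp.smul_apply, smul_eq_mul]
  linear_combination (q 1 - p 1) * hu + (p 1 * (q 0 - p 0) - p 0 * (q 1 - p 1)) * hab

theorem mem_segment_of_vertical {u z z' : Pt} (hz : z 0 = u 0) (hz' : z' 0 = u 0)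
    (hu : u 1 ∈ Set.uIcc (z 1) (z' 1)) : u ∈ segment ℝ z z' := by
  rw [← segment_eq_uIcc] at hu
  obtain ⟨a, b, ha, hb, hab, hu⟩ := hu
  refine ⟨a, b, ha, hb, hab, PiLp.ext (Fin.forall_fin_two.2 ⟨?_, by simpa using hu⟩)⟩
  simp [hz, hz', ← add_mul, hab]

theorem dist_eq_of_vertical {u z : Pt} (hz : z 0 = u 0) : dist u z = |u 1 - z 1| := by
  simp [EuclideanSpace.dist_eq, Real.dist_eq, hz, Real.sqrt_sq_eq_abs]

/-- The point `u` lies in the closed vertical strip between `p` and `q`, which is nondegenerate; the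
sign `σ = ±1` is that of `q 0 - p 0`, so the left side of `pq` is above the segment for `σ = 1` and
below it for `σ = -1`. -/
structure InStrip (σ : ℝ) (p q u : Pt) : Prop where
  abs_eq_one : |σ| = 1
  width_pos : 0 < σ * (q 0 - p 0)
  left_nonneg : 0 ≤ σ * (u 0 - p 0)
  right_nonneg : 0 ≤ σ * (q 0 - u 0)

/-- `S` meets the vertical ray that starts at height `e` above `u` and goes down through `u`, for
`σ = 1`; for `σ = -1` the picture is reflected in the horizontal line through `u`. -/
def MeetsVerticalRay (S : Set Pt) (σ e : ℝ) (u : Pt) : Prop :=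
  ∃ z ∈ S, z 0 = u 0 ∧ σ * (z 1 - u 1) ≤ e

theorem MeetsVerticalRay.mono {S T : Set Pt} {σ e : ℝ} {u : Pt} (h : MeetsVerticalRay S σ e u)
    (hST : S ⊆ T) : MeetsVerticalRay T σ e u :=
  h.imp fun _ => And.imp_left (@hST _)

theorem infDist_le_of_meetsVerticalRay {S : Set Pt} (hS : Convex ℝ S) {σ e : ℝ} {u : Pt}
    (hσ : |σ| = 1) (he : 0 ≤ e) (h : MeetsVerticalRay S σ e u)
    (h' : MeetsVerticalRay S (-σ) e u) : Metric.infDist u S ≤ e := by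
  obtain ⟨z, hz, hz₀, hzu⟩ := h
  obtain ⟨z', hz', hz₀', hzu'⟩ := h'
  have habs (x : ℝ) : |x| = |σ * x| := by rw [abs_mul, hσ, one_mul]
  have hnear {y : Pt} (hy : y ∈ S) (hy₀ : y 0 = u 0) (hyu : |y 1 - u 1| ≤ e) :
      Metric.infDist u S ≤ e :=
    (Metric.infDist_le_dist_of_mem hy).trans (by rwa [dist_eq_of_vertical hy₀, abs_sub_comm])
  rcases le_or_gt |z 1 - u 1| e with hle | hlt
  · exact hnear hz hz₀ hle
  rcases le_or_gt |z' 1 - u 1| e with hle' | hlt'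
  · exact hnear hz' hz₀' hle'
  have hneg : σ * (z 1 - u 1) < 0 := by
    by_contra! hnonneg
    rw [habs, abs_of_nonneg hnonneg] at hlt
    linarith
  have hpos : 0 < σ * (z' 1 - u 1) := by
    by_contra! hnonpos
    rw [habs, abs_of_nonpos hnonpos] at hlt'
    linarith
  have hmem : u ∈ segment ℝ z z' := by
    refine mem_segment_of_vertical hz₀ hz₀' (Set.mem_uIcc.2 ?_)
    rcases (abs_eq zero_le_one).1 hσ with rfl | rfl
    exacts [.inl ⟨by linarith, by linarith⟩, .inr ⟨by linarith, by linarith⟩]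
  rwa [Metric.infDist_zero_of_mem (hS.segment_subset hz hz' hmem)]

namespace InStrip

variable {σ : ℝ} {p q u : Pt}

theorem swap (h : InStrip σ p q u) : InStrip (-σ) q p u where
  abs_eq_one := by rw [abs_neg, h.abs_eq_one]
  width_pos := by linarith [h.width_pos]
  left_nonneg := by linarith [h.right_nonneg]
  right_nonneg := by linarith [h.left_nonneg]

theorem split (h : InStrip σ p q u) (r : Pt) : InStrip σ p r u ∨ InStrip σ r q u := by
  obtain ⟨hσ, hpq, hpu, huq⟩ := h
  by_cases hr : 0 < σ * (r 0 - p 0) ∧ 0 ≤ σ * (r 0 - u 0)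
  · exact .inl ⟨hσ, hr.1, hpu, hr.2⟩
  · refine .inr ⟨hσ, ?_, ?_, huq⟩ <;> by_contra! hneg <;> exact hr ⟨by linarith, by linarith⟩

theorem mem_uIcc (h : InStrip σ p q u) : u 0 ∈ Set.uIcc (p 0) (q 0) := by
  obtain ⟨hσ, -, hpu, huq⟩ := h
  rcases (abs_eq zero_le_one).1 hσ with rfl | rfl
  · exact Set.mem_uIcc_of_le (by linarith) (by linarith)
  · exact Set.mem_uIcc_of_ge (by linarith) (by linarith)

theorem abs_width_eq (h : InStrip σ p q u) : |q 0 - p 0| = σ * (q 0 - p 0) := by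
  rw [← abs_of_pos h.width_pos, abs_mul, h.abs_eq_one, one_mul]

theorem meetsVerticalRay (h : InStrip σ p q u) {e : ℝ} (he : -orient p u q ≤ e * |q 0 - p 0|) :
    MeetsVerticalRay (segment ℝ p q) σ e u := by
  obtain ⟨z, hz, hz₀, horient⟩ := exists_mem_segment_vertical h.mem_uIcc
  refine ⟨z, hz, hz₀, le_of_mul_le_mul_right ?_ h.width_pos⟩
  calc σ * (z 1 - u 1) * (σ * (q 0 - p 0)) = |σ| ^ 2 * -orient p u q := by
        rw [horient, sq_abs]; ring
    _ ≤ e * |q 0 - p 0| := by rwa [h.abs_eq_one, one_pow, one_mul]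
    _ = e * (σ * (q 0 - p 0)) := by rw [h.abs_width_eq]

theorem meetsVerticalRay_neg (h : InStrip σ p q u) {e : ℝ} (he : orient p u q ≤ e * |q 0 - p 0|) :
    MeetsVerticalRay (segment ℝ p q) (-σ) e u := by
  rw [segment_symm]
  refine h.swap.meetsVerticalRay ?_
  rw [abs_sub_comm]
  exact (by unfold orient; ring : -orient q u p = orient p u q).trans_le he

end InStrip

theorem exists_inStrip {p q u : Pt} (hpq : p 0 ≠ q 0) (hu : u 0 ∈ Set.uIcc (p 0) (q 0)) :
    ∃ σ, InStrip σ p q u := by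
  rcases hpq.lt_or_gt with hlt | hlt
  · rw [Set.uIcc_of_lt hlt] at hu
    exact ⟨1, abs_one, by linarith, by linarith [hu.1], by linarith [hu.2]⟩
  · rw [Set.uIcc_of_gt hlt] at hu
    exact ⟨-1, by simp, by linarith, by linarith [hu.2], by linarith [hu.1]⟩

theorem apply_zero_ne_of_rtHat {fl : ℝ → ℝ} (h₀ : fl 0 = 0) {p q u : Pt}
    (hu : u 0 ∈ Set.uIcc (p 0) (q 0)) (hrt : rtHat fl p u q) : p 0 ≠ q 0 := by
  intro hpq
  rw [hpq, Set.uIcc_self, Set.mem_singleton_iff] at hu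
  simp [rtHat, hpq, hu, h₀] at hrt

theorem mem_leftOf {fl : ℝ → ℝ} {p q u : Pt} {L : List Pt} :
    u ∈ leftOf fl p q L ↔ u ∈ L ∧ rtHat fl p u q := by
  simp [leftOf]

theorem leftOf_subset (fl : ℝ → ℝ) (p q : Pt) (L : List Pt) : leftOf fl p q L ⊆ L :=
  fun _ hu => (mem_leftOf.1 hu).1

theorem cons_cons_leftOf_subset {p q : Pt} {L P : List Pt} (hp : p ∈ P) (hq : q ∈ P) (hL : L ⊆ P)
    (fl : ℝ → ℝ) : p :: q :: leftOf fl p q L ⊆ P := by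
  simp [hp, hq, List.Subset.trans (leftOf_subset fl p q L) hL]

theorem mem_CH {P : List Pt} {u : Pt} (h : u ∈ P) : u ∈ CH P := subset_convexHull ℝ _ h

theorem CH_mono {P Q : List Pt} (h : P ⊆ Q) : CH P ⊆ CH Q := convexHull_mono h

theorem convex_CH (P : List Pt) : Convex ℝ (CH P) := convex_convexHull ℝ _

theorem infDist_CH_mono {P Q : List Pt} (h : P ⊆ Q) (hP : P ≠ []) (u : Pt) :
    Metric.infDist u (CH Q) ≤ Metric.infDist u (CH P) :=
  Metric.infDist_le_infDist_of_subset (CH_mono h)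
    ⟨_, mem_CH (List.head_mem hP)⟩

theorem HullRun.subset {fl : ℝ → ℝ} {s : Scheme} {L H : List Pt} {p r q : Pt} {D : ℕ}
    (hrun : HullRun fl s L p r q H D) (hr : r ∈ p :: L) : H ⊆ p :: q :: L := by
  induction hrun with
  | base L p r q => exact fun v hv => List.mem_cons_of_mem p (List.mem_cons_of_mem q hv)
  | step L p r q H₁ H₂ _ _ _ _ _ ih₁ ih₂ =>
    have hp' : p ∈ p :: q :: L := List.mem_cons_self
    have hq' : q ∈ p :: q :: L := by simp
    have hL : L ⊆ p :: q :: L := fun _ h => .tail p (.tail q h)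
    have hr' : r ∈ p :: q :: L := List.cons_subset.2 ⟨hp', hL⟩ hr
    have hpr := cons_cons_leftOf_subset hp' hr' hL fl
    have hrq := cons_cons_leftOf_subset hr' hq' hL fl
    have hH₁ := List.Subset.trans (ih₁ (farthest_mem_cons ..)) hpr
    have hH₂ := List.Subset.trans (ih₂ (farthest_mem_cons ..)) hrq
    simp only [List.append_subset, List.cons_subset, List.nil_subset, and_true]
    exact ⟨⟨⟨⟨hp', hH₁⟩, hr'⟩, hH₂⟩, hq'⟩

section ForwardError

variable {fl : ℝ → ℝ} {ε : ℝ} {s : Scheme} {p q r u : Pt} {L H P : List Pt} {D : ℕ}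

theorem IsRounding.neg_orient_le_of_rtHat (h : IsRounding fl ε) (hε : 6 * ε < 1)
    (hrt : rtHat fl p u q) : -orient p u q ≤ gamma6 ε * |p 1 - u 1| * |q 0 - p 0| := by
  rw [orient_eq, neg_sub, mul_assoc, ← abs_mul]
  refine (h.sub_le_of_map_mul_le hε (le_of_lt hrt)).trans ?_
  gcongr
  exacts [gamma6_nonneg h.nonneg hε, min_le_left _ _]

theorem IsRounding.orient_le_of_not_rtHat (h : IsRounding fl ε) (hε : 6 * ε < 1)
    (hrt : ¬ rtHat fl p u q) : orient p u q ≤ gamma6 ε * |p 1 - u 1| * |q 0 - p 0| := by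
  rw [orient_eq, mul_assoc, ← abs_mul]
  refine (h.sub_le_of_map_mul_le hε (not_lt.1 hrt)).trans ?_
  gcongr
  exacts [gamma6_nonneg h.nonneg hε, min_le_right _ _]

theorem InStrip.infDist_le {σ B : ℝ} {S : Set Pt} (hs : InStrip σ p q u) (h : IsRounding fl ε)
    (hε : 6 * ε < 1) (hS : Convex ℝ S) (hp : p ∈ S) (hq : q ∈ S) (hB : |p 1 - u 1| ≤ B)
    (hray : MeetsVerticalRay S σ (gamma6 ε * B) u)
    (hleft : rtHat fl p u q → Metric.infDist u S ≤ gamma6 ε * B) :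
    Metric.infDist u S ≤ gamma6 ε * B := by
  have hγ := gamma6_nonneg h.nonneg hε
  by_cases hrt : rtHat fl p u q
  · exact hleft hrt
  · have hedge : MeetsVerticalRay (segment ℝ p q) (-σ) (gamma6 ε * B) u := by
      refine hs.meetsVerticalRay_neg ((h.orient_le_of_not_rtHat hε hrt).trans ?_)
      gcongr
    exact infDist_le_of_meetsVerticalRay hS hs.abs_eq_one
      (mul_nonneg hγ ((abs_nonneg _).trans hB)) hray (hedge.mono (hS.segment_subset hp hq))

theorem HullRun.infDist_le {σ B : ℝ} (hrun : HullRun fl s L p r q H D) (h : IsRounding fl ε)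
    (hε : 6 * ε < 1) (hr : r ∈ p :: L) (hB : ∀ v ∈ p :: q :: L, |v 1 - u 1| ≤ B)
    (hs : InStrip σ p q u) (hu : u ∈ L) (hrt : rtHat fl p u q) :
    Metric.infDist u (CH (p :: q :: H)) ≤ gamma6 ε * B := by
  have hγ := gamma6_nonneg h.nonneg hε
  have hB₀ : 0 ≤ B := (abs_nonneg _).trans (hB p List.mem_cons_self)
  induction hrun with
  | base L p r q =>
    have hmem : u ∈ p :: q :: L := List.mem_cons_of_mem p (List.mem_cons_of_mem q hu)
    rw [Metric.infDist_zero_of_mem (mem_CH hmem)]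
    positivity
  | step L p r q H₁ H₂ _ _ _ _ _ ih₁ ih₂ =>
    have hp' : p ∈ p :: q :: L := List.mem_cons_self
    have hq' : q ∈ p :: q :: L := by simp
    have hL : L ⊆ p :: q :: L := fun _ h => .tail p (.tail q h)
    have hr' : r ∈ p :: q :: L := List.cons_subset.2 ⟨hp', hL⟩ hr
    have hpr := cons_cons_leftOf_subset hp' hr' hL fl
    have hrq := cons_cons_leftOf_subset hr' hq' hL fl
    have hp : p ∈ CH (p :: q :: ([p] ++ H₁ ++ [r] ++ H₂ ++ [q])) := mem_CH (by simp)
    have hq : q ∈ CH (p :: q :: ([p] ++ H₁ ++ [r] ++ H₂ ++ [q])) := mem_CH (by simp)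
    have hr : r ∈ CH (p :: q :: ([p] ++ H₁ ++ [r] ++ H₂ ++ [q])) := mem_CH (by simp)
    have hpB : |p 1 - u 1| ≤ B := hB p hp'
    have hrB : |r 1 - u 1| ≤ B := hB r hr'
    have hray : MeetsVerticalRay (CH (p :: q :: ([p] ++ H₁ ++ [r] ++ H₂ ++ [q]))) σ
        (gamma6 ε * B) u := by
      refine (hs.meetsVerticalRay ((h.neg_orient_le_of_rtHat hε hrt).trans ?_)).mono
        ((convex_CH _).segment_subset hp hq)
      gcongr
    rcases hs.split r with hs | hs
    · refine hs.infDist_le h hε (convex_CH _) hp hr hpB hray fun hrt =>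
        (infDist_CH_mono ?_ (List.cons_ne_nil p (r :: H₁)) u).trans <|
          ih₁ (farthest_mem_cons ..) (fun v hv => hB v (hpr hv)) hs (mem_leftOf.2 ⟨hu, hrt⟩) hrt
      simp +contextual [List.subset_def]
    · refine hs.infDist_le h hε (convex_CH _) hr hq hrB hray fun hrt =>
        (infDist_CH_mono ?_ (List.cons_ne_nil r (q :: H₂)) u).trans <|
          ih₂ (farthest_mem_cons ..) (fun v hv => hB v (hrq hv)) hs (mem_leftOf.2 ⟨hu, hrt⟩) hrt
      simp +contextual [List.subset_def]

end ForwardError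

/-! ### Forward error -/

theorem infDist_le_of_mem_convexHull {E : Type*} [SeminormedAddCommGroup E] [NormedSpace ℝ E]
    {S A : Set E} (hS : Convex ℝ S) (hne : S.Nonempty) {δ : ℝ} (hδ : 0 ≤ δ)
    (hA : ∀ u ∈ A, Metric.infDist u S ≤ δ) {x : E} (hx : x ∈ convexHull ℝ A) :
    Metric.infDist x S ≤ δ := by
  have hmem (y : E) : y ∈ Metric.cthickening δ S ↔ Metric.infDist y S ≤ δ := by
    rw [Metric.mem_cthickening_iff,
      ENNReal.le_ofReal_iff_toReal_le (Metric.infEDist_ne_top hne) hδ, Metric.infDist]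
  exact (hmem x).1 (convexHull_min (fun u hu => (hmem u).2 (hA u hu)) (hS.cthickening δ) hx)

theorem forwardError_le_of_infDist_le {H P : List Pt} {e : ℝ} (he : 0 ≤ e) (hH : H ≠ [])
    (hHP : H ⊆ P) (h : ∀ u ∈ P, Metric.infDist u (CH H) ≤ e * maxCoord P) :
    forwardError H P ≤ e := by
  have heM : 0 ≤ e * maxCoord P := mul_nonneg he (maxCoord_nonneg P)
  have hne : (CH H).Nonempty := ⟨_, mem_CH (List.head_mem hH)⟩
  refine div_le_of_le_mul₀ (maxCoord_nonneg P) he (Metric.hausdorffDist_le_of_infDist heM ?_ ?_)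
  · intro x hx
    rwa [Metric.infDist_zero_of_mem (CH_mono hHP hx)]
  · exact fun x hx => infDist_le_of_mem_convexHull (convex_CH H) hne heM h hx

theorem forwardError_eq_zero {H P : List Pt} (hHP : H ⊆ P) (hPH : P ⊆ H) :
    forwardError H P = 0 := by
  rw [forwardError, (CH_mono hHP).antisymm (CH_mono hPH), Metric.hausdorffDist_self_zero, zero_div]

section RunError

variable {fl : ℝ → ℝ} {ε : ℝ} {s : Scheme} {p q : Pt} {L H P : List Pt} {D : ℕ}

theorem HullRun.forwardError_le (hrun : HullRun fl s L p (farthest fl s p q L) q H D)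
    (h : IsRounding fl ε) (hε : 6 * ε < 1) (hL : ∀ u ∈ L, u 0 ∈ Set.uIcc (p 0) (q 0))
    (hrt : ∀ u ∈ L, rtHat fl p u q) : forwardError (p :: q :: H) (p :: q :: L) ≤ 2 * gamma6 ε := by
  have hγ := gamma6_nonneg h.nonneg hε
  have hr := farthest_mem_cons fl s p q L
  refine forwardError_le_of_infDist_le (by positivity) (List.cons_ne_nil p _) ?_ ?_
  · simpa [List.cons_subset] using hrun.subset hr
  · intro u hu
    have hB : ∀ v ∈ p :: q :: L, |v 1 - u 1| ≤ 2 * maxCoord (p :: q :: L) :=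
      fun v hv => abs_sub_apply_le_two_mul_maxCoord hv hu 1
    have hM := maxCoord_nonneg (p :: q :: L)
    by_cases huL : u ∈ L
    · obtain ⟨σ, hs⟩ :=
        exists_inStrip (apply_zero_ne_of_rtHat h.map_zero (hL u huL) (hrt u huL)) (hL u huL)
      exact (hrun.infDist_le h hε hr hB hs huL (hrt u huL)).trans_eq (by ring)
    · have huH : u ∈ p :: q :: H := by
        simp only [List.mem_cons, huL, or_false] at hu ⊢
        tauto
      rw [Metric.infDist_zero_of_mem (mem_CH huH)]
      positivity

theorem QuickhullRun.subset (hrun : QuickhullRun fl s P H D) : H ⊆ P := by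
  obtain ⟨p, q, H₁, H₂, D₁, D₂, ⟨hp, hq, -⟩, h₁, h₂, rfl, -⟩ := hrun
  have hH₁ := List.Subset.trans (h₁.subset (farthest_mem_cons ..))
    (cons_cons_leftOf_subset hp hq (List.Subset.refl P) fl)
  have hH₂ := List.Subset.trans (h₂.subset (farthest_mem_cons ..))
    (cons_cons_leftOf_subset hq hp (List.Subset.refl P) fl)
  simp [hp, hq, hH₁, hH₂]

theorem IsExtremePair.mem_segment (hpq : IsExtremePair P p q) (heq : p 0 = q 0) {u : Pt}
    (hu : u ∈ P) : u ∈ segment ℝ p q := by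
  obtain ⟨-, -, hstrip, hvert⟩ := hpq
  have hu₀ := hstrip u hu
  exact mem_segment_of_vertical (by linarith) (by linarith)
    (Set.mem_uIcc_of_le (hvert heq u hu).1 (hvert heq u hu).2)

theorem IsExtremePair.inStrip (hpq : IsExtremePair P p q) (hne : p 0 ≠ q 0) {u : Pt}
    (hu : u ∈ P) : InStrip 1 p q u := by
  have hu₀ := hpq.2.2.1 u hu
  have hlt := (hu₀.1.trans hu₀.2).lt_of_ne hne
  exact ⟨abs_one, by linarith, by linarith, by linarith⟩

theorem IsExtremePair.infDist_le {H₁ H₂ : List Pt} {D₁ D₂ : ℕ} (hpq : IsExtremePair P p q)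
    (h : IsRounding fl ε) (hε : 6 * ε < 1)
    (h₁ : HullRun fl s (leftOf fl p q P) p (farthest fl s p q (leftOf fl p q P)) q H₁ D₁)
    (h₂ : HullRun fl s (leftOf fl q p P) q (farthest fl s q p (leftOf fl q p P)) p H₂ D₂)
    {u : Pt} (hu : u ∈ P) :
    Metric.infDist u (CH ([p] ++ H₁ ++ [q] ++ H₂)) ≤ gamma6 ε * (2 * maxCoord P) := by
  have hγ := gamma6_nonneg h.nonneg hε
  have hM := maxCoord_nonneg P
  have hp := hpq.1
  have hq := hpq.2.1
  have hpH : p ∈ CH ([p] ++ H₁ ++ [q] ++ H₂) := mem_CH (by simp)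
  have hqH : q ∈ CH ([p] ++ H₁ ++ [q] ++ H₂) := mem_CH (by simp)
  by_cases heq : p 0 = q 0
  · rw [Metric.infDist_zero_of_mem
      ((convex_CH _).segment_subset hpH hqH (hpq.mem_segment heq hu))]
    positivity
  have hs := hpq.inStrip heq hu
  have hB {v : Pt} (hv : v ∈ P) := abs_sub_apply_le_two_mul_maxCoord hv hu 1
  have hpqP := cons_cons_leftOf_subset hp hq (List.Subset.refl P) fl
  have hqpP := cons_cons_leftOf_subset hq hp (List.Subset.refl P) fl
  by_cases hrt : rtHat fl p u q
  · refine (infDist_CH_mono ?_ (List.cons_ne_nil p (q :: H₁)) u).trans <| h₁.infDist_le h hε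
      (farthest_mem_cons ..) (fun v hv => hB (hpqP hv)) hs (mem_leftOf.2 ⟨hu, hrt⟩) hrt
    simp +contextual [List.subset_def]
  · have hray : MeetsVerticalRay (CH ([p] ++ H₁ ++ [q] ++ H₂)) (-1)
        (gamma6 ε * (2 * maxCoord P)) u := by
      refine (hs.meetsVerticalRay_neg ((h.orient_le_of_not_rtHat hε hrt).trans ?_)).mono
        ((convex_CH _).segment_subset hpH hqH)
      gcongr
      exact hB hp
    refine hs.swap.infDist_le h hε (convex_CH _) hqH hpH (hB hq) hray fun hrt =>
      (infDist_CH_mono ?_ (List.cons_ne_nil q (p :: H₂)) u).trans <| h₂.infDist_le h hε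
        (farthest_mem_cons ..) (fun v hv => hB (hqpP hv)) hs.swap (mem_leftOf.2 ⟨hu, hrt⟩) hrt
    simp +contextual [List.subset_def]

theorem QuickhullRun.forwardError_le (hrun : QuickhullRun fl s P H D) (h : IsRounding fl ε)
    (hε : 6 * ε < 1) : forwardError H P ≤ 2 * gamma6 ε := by
  have hHP := hrun.subset
  obtain ⟨p, q, H₁, H₂, D₁, D₂, hpq, h₁, h₂, rfl, -⟩ := hrun
  have hγ := gamma6_nonneg h.nonneg hε
  exact forwardError_le_of_infDist_le (by positivity) (by simp) hHP fun u hu =>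
    (hpq.infDist_le h hε h₁ h₂ hu).trans_eq (by ring)

end RunError

/-! ### Termination and depth -/

section Depth

variable {fl : ℝ → ℝ} {s : Scheme} {p q r : Pt} {L H P : List Pt} {D : ℕ}

theorem not_rtHat_left (h₀ : fl 0 = 0) (p q : Pt) : ¬ rtHat fl p p q := by
  simp [rtHat, h₀]

theorem not_rtHat_right (hodd : Function.Odd fl) (p q : Pt) : ¬ rtHat fl p q q := by
  rw [rtHat, ← neg_sub (q 0), ← neg_sub (p 1), hodd, hodd, neg_mul_neg, mul_comm]
  exact lt_irrefl _

theorem length_leftOf_lt (hr : r ∈ L) (hrt : ¬ rtHat fl p r q) :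
    (leftOf fl p q L).length < L.length := by
  rw [leftOf, List.length_filter_lt_length_iff_exists]
  exact ⟨r, hr, by simpa using hrt⟩

theorem exists_hullRun (hodd : Function.Odd fl) (s : Scheme) (L : List Pt) (p r q : Pt)
    (hr : L ≠ [] → r ∈ L) : ∃ H D, HullRun fl s L p r q H D := by
  induction hn : L.length using Nat.strong_induction_on generalizing L p r q with | _ n ih
  subst hn
  rcases le_or_gt L.length 1 with hL | hL
  · exact ⟨L, 0, .base L p r q hL⟩
  · have hr := hr (List.length_pos_iff.1 (zero_lt_one.trans hL))
    obtain ⟨H₁, D₁, h₁⟩ := ih _ (length_leftOf_lt hr (not_rtHat_right hodd p r))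
      (leftOf fl p r L) p _ r (farthest_mem fl s p r) rfl
    obtain ⟨H₂, D₂, h₂⟩ := ih _ (length_leftOf_lt hr (not_rtHat_left hodd.map_zero r q))
      (leftOf fl r q L) r _ q (farthest_mem fl s r q) rfl
    exact ⟨_, _, .step L p r q H₁ H₂ D₁ D₂ hL h₁ h₂⟩

theorem HullRun.depth_le (hrun : HullRun fl s L p r q H D) (hodd : Function.Odd fl)
    (hr : L ≠ [] → r ∈ L) : D ≤ L.length - 1 := by
  induction hrun with
  | base => exact Nat.zero_le _
  | step L p r q _ _ _ _ hL _ _ ih₁ ih₂ =>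
    have hr := hr (List.length_pos_iff.1 (zero_lt_one.trans hL))
    have hD₁ := ih₁ (farthest_mem fl s p r)
    have hD₂ := ih₂ (farthest_mem fl s r q)
    have hlt₁ := length_leftOf_lt hr (not_rtHat_right hodd p r)
    have hlt₂ := length_leftOf_lt hr (not_rtHat_left hodd.map_zero r q)
    omega

theorem HullRun.depth_eq_zero (hrun : HullRun fl s L p r q H D) (hL : L.length ≤ 1) : D = 0 := by
  cases hrun with
  | base => rfl
  | step _ _ _ _ _ _ _ _ hlt => exact absurd hL hlt.not_ge

theorem HullRun.one_le_depth (hrun : HullRun fl s L p r q H D) (hL : 2 ≤ L.length) : 1 ≤ D := by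
  cases hrun with
  | base _ _ _ _ hle => exact absurd hL hle.not_gt
  | step => exact Nat.le_add_left 1 _

theorem exists_isExtremePair (hP : P ≠ []) : ∃ p q, IsExtremePair P p q := by
  have hne : P.toFinset.Nonempty := List.toFinset_nonempty_iff P |>.2 hP
  obtain ⟨p, hp, hmin⟩ := P.toFinset.exists_min_image (fun u : Pt => toLex (u 0, u 1)) hne
  obtain ⟨q, hq, hmax⟩ := P.toFinset.exists_max_image (fun u : Pt => toLex (u 0, u 1)) hne
  simp only [List.mem_toFinset, Prod.Lex.toLex_le_toLex] at hp hmin hq hmax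
  refine ⟨p, q, hp, hq, fun u hu => ⟨?_, ?_⟩, fun heq u hu => ⟨?_, ?_⟩⟩ <;> grind

theorem exists_quickhullRun (hodd : Function.Odd fl) (s : Scheme) (hP : P ≠ []) :
    ∃ H D, QuickhullRun fl s P H D := by
  obtain ⟨p, q, hpq⟩ := exists_isExtremePair hP
  obtain ⟨H₁, D₁, h₁⟩ := exists_hullRun hodd s (leftOf fl p q P) p _ q (farthest_mem fl s p q)
  obtain ⟨H₂, D₂, h₂⟩ := exists_hullRun hodd s (leftOf fl q p P) q _ p (farthest_mem fl s q p)
  exact ⟨_, _, p, q, H₁, H₂, D₁, D₂, hpq, h₁, h₂, rfl, rfl⟩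

namespace QuickhullRun

theorem one_le_length (hrun : QuickhullRun fl s P H D) : 1 ≤ P.length := by
  obtain ⟨p, _, _, _, _, _, ⟨hp, -⟩, -⟩ := hrun
  exact List.length_pos_of_mem hp

theorem one_le_depth (hrun : QuickhullRun fl s P H D) : 1 ≤ D := by
  obtain ⟨_, _, _, _, _, _, -, -, -, -, rfl⟩ := hrun
  exact Nat.le_add_left 1 _

theorem depth_le (hrun : QuickhullRun fl s P H D) (hodd : Function.Odd fl) : D ≤ P.length := by
  obtain ⟨p, q, H₁, H₂, D₁, D₂, ⟨hp, hq, -⟩, h₁, h₂, -, rfl⟩ := hrun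
  have hD₁ := h₁.depth_le hodd (farthest_mem fl s p q)
  have hD₂ := h₂.depth_le hodd (farthest_mem fl s q p)
  have hlt₁ := length_leftOf_lt (q := q) hp (not_rtHat_left hodd.map_zero p q)
  have hlt₂ := length_leftOf_lt (q := p) hq (not_rtHat_left hodd.map_zero q p)
  omega

theorem forwardError_eq_zero (hrun : QuickhullRun fl s P H D) (hP : P.length ≤ 1) :
    forwardError H P = 0 := by
  have hHP := hrun.subset
  obtain ⟨a, rfl⟩ := List.length_eq_one_iff.1 (hP.antisymm hrun.one_le_length)
  obtain ⟨p, _, _, _, _, _, ⟨hp, -⟩, -, -, rfl, -⟩ := hrun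
  obtain rfl := List.mem_singleton.1 hp
  exact FloatQuickhull.forwardError_eq_zero hHP (by simp)

end QuickhullRun

end Depth

theorem HullRun.forwardError_eq_zero {fl : ℝ → ℝ} {s : Scheme} {L H : List Pt} {p r q : Pt} {D : ℕ}
    (hrun : HullRun fl s L p r q H D) (hL : L.length ≤ 1) :
    forwardError (p :: q :: H) (p :: q :: L) = 0 := by
  cases hrun with
  | base => exact FloatQuickhull.forwardError_eq_zero (fun _ => id) (fun _ => id)
  | step _ _ _ _ _ _ _ _ hlt => exact absurd hL hlt.not_ge

/-! ### Error bounds in terms of the depth -/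

theorem IsReductionBound.apply_one_nonneg {fl : ℝ → ℝ} {s : Scheme} {F : ℕ → ℝ}
    (hF : IsReductionBound fl s F) : 0 ≤ F 1 := by
  have hbound := hF [!₂[0, 1]] !₂[0, 0] !₂[1, 0] (by simp)
    (fun h => by simpa using congrArg (fun v : Pt => v 0) h) (by simp [orient]) _
    (farthest_mem fl s !₂[0, 0] !₂[1, 0] (by simp))
  simpa using hbound

theorem chain_nonneg (s : Scheme) (n : ℕ) : 0 ≤ chain s n := by
  cases s <;> simp only [chain] <;> positivity

theorem one_le_chain (s : Scheme) {n : ℕ} (hn : 2 ≤ n) : 1 ≤ chain s n := by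
  cases s with
  | simple => exact Nat.one_le_cast.2 (Nat.le_sub_one_of_lt hn)
  | blocked m =>
    have hm : (1 : ℝ) ≤ m := Nat.one_le_cast.2 m.pos
    exact hm.trans (le_add_of_nonneg_right (by positivity))
  | pairwise => exact Nat.one_le_cast.2 (Nat.clog_pos one_lt_two hn)

theorem le_two_mul_depth_mul {e γ x : ℝ} {n D : ℕ} (he : e ≤ 2 * γ ∧ (n ≤ 1 → e = 0))
    (hγ : 0 ≤ γ) (hD : 2 ≤ n → 1 ≤ D) (hx₀ : n ≤ 1 → 0 ≤ D * x) (hx : 2 ≤ n → γ ≤ x) :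
    e ≤ 2 * D * x := by
  rcases Nat.lt_or_ge 1 n with hn | hn
  · calc e ≤ 2 * 1 * γ := by simpa using he.1
      _ ≤ 2 * D * x := by gcongr; exacts [Nat.one_le_cast.2 (hD hn), hx hn]
  · linarith [he.2 hn, hx₀ hn]

theorem le_mul_depth_mul {e ε κ : ℝ} {n D : ℕ} (he : e ≤ 2 * gamma6 ε ∧ (n ≤ 1 → e = 0))
    (hε : 0 ≤ ε) (hε' : 12 * ε ≤ 1) (hD : 1 ≤ D) (hκ₀ : 0 ≤ κ) (hκ : 2 ≤ n → 1 ≤ 2 * κ) :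
    e ≤ 48 * (D * κ * ε) := by
  have hx (hn : 2 ≤ n) : gamma6 ε ≤ 24 * κ * ε := by
    nlinarith [gamma6_le hε hε', hκ hn]
  exact (le_two_mul_depth_mul he (gamma6_nonneg hε (by linarith)) (fun _ => hD)
    (fun _ => by positivity) hx).trans_eq (by ring)

theorem one_le_two_mul_log {n : ℕ} (hn : 2 ≤ n) : 1 ≤ 2 * Real.log n := by
  have hlog : Real.log 2 ≤ Real.log n := Real.log_le_log two_pos (Nat.ofNat_le_cast.2 hn)
  linarith [Real.log_two_gt_d9]

end FloatQuickhull

open FloatQuickhull in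
theorem mainTheorem1_general :
    (∀ (ε : ℝ) (fl : ℝ → ℝ) (s : Scheme), 6 * ε < 1 → IsRounding fl ε →
      IsReductionBound fl s (fun n => 2 * gamma6 ε * chain s n) ∧
      (∀ (P H : List Pt) (D : ℕ), QuickhullRun fl s P H D →
        forwardError H P ≤ 2 * gamma6 ε ∧ (P.length ≤ 1 → forwardError H P = 0)) ∧
      (∀ (L : List Pt) (p q : Pt) (H : List Pt) (D : ℕ),
        (∀ u ∈ L, u 0 ∈ Set.uIcc (p 0) (q 0)) → (∀ u ∈ L, rtHat fl p u q) →
        HullRun fl s L p (farthest fl s p q L) q H D →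
          forwardError (p :: q :: H) (p :: q :: L) ≤ 2 * gamma6 ε ∧
          (L.length ≤ 1 → forwardError (p :: q :: H) (p :: q :: L) = 0))) ∧
    (∀ (fl : ℝ → ℝ) (s : Scheme), Function.Odd fl → ∀ P : List Pt, P ≠ [] →
      (∃ (H : List Pt) (D : ℕ), QuickhullRun fl s P H D) ∧
      ∀ (H : List Pt) (D : ℕ), QuickhullRun fl s P H D → D ≤ P.length) :=
  ⟨fun _ _ s hε h => ⟨isReductionBound_gamma6 h hε s,
      fun _ _ _ hrun => ⟨hrun.forwardError_le h hε, hrun.forwardError_eq_zero⟩,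
      fun _ _ _ _ _ hstrip hleft hrun =>
        ⟨hrun.forwardError_le h hε hstrip hleft, hrun.forwardError_eq_zero⟩⟩,
    fun _ s hodd _ hP => ⟨exists_quickhullRun hodd s hP, fun _ _ hrun => hrun.depth_le hodd⟩⟩

open FloatQuickhull in
theorem mainTheorem1 :
    (∀ (ε : ℝ) (fl : ℝ → ℝ) (s : Scheme), 0 ≤ ε → 6 * ε < 1 → IsRounding fl ε →
      -- a valid bound for the farthest-point reduction
      IsReductionBound fl s (fun n => 2 * gamma6 ε * chain s n) ∧
      -- Quickhull, for every bound `F` of the reduction that is not below `γ₆`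
      (∀ F : ℕ → ℝ, IsReductionBound fl s F →
        ∀ (P H : List Pt) (D : ℕ), (2 ≤ P.length → gamma6 ε ≤ F P.length) →
          QuickhullRun fl s P H D → forwardError H P ≤ 2 * D * F P.length) ∧
      -- Quickhull, with the error `γ₆` per comparison
      (∀ (P H : List Pt) (D : ℕ), QuickhullRun fl s P H D →
        forwardError H P ≤ 2 * D * (gamma6 ε * chain s P.length)) ∧
      -- the recursive function HULL, called for the points on one side of an extreme pair
      (∀ (L : List Pt) (p q : Pt) (H : List Pt) (D : ℕ),
        ((∀ u ∈ L, p 0 ≤ u 0 ∧ u 0 ≤ q 0) ∨ (∀ u ∈ L, q 0 ≤ u 0 ∧ u 0 ≤ p 0)) →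
        (∀ u ∈ L, rtHat fl p u q) →
        HullRun fl s L p (farthest fl s p q L) q H D →
          forwardError (p :: q :: H) (p :: q :: L) ≤ 2 * D * (gamma6 ε * chain s L.length) ∧
          ∀ F : ℕ → ℝ, IsReductionBound fl s F → (2 ≤ L.length → gamma6 ε ≤ F L.length) →
            forwardError (p :: q :: H) (p :: q :: L) ≤ 2 * D * F L.length) ∧
      -- termination and depth, for rounding that is symmetric about zero
      ((∀ x : ℝ, fl (-x) = -fl x) → ∀ P : List Pt, P ≠ [] →
        (∃ (H : List Pt) (D : ℕ), QuickhullRun fl s P H D) ∧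
        ∀ (H : List Pt) (D : ℕ), QuickhullRun fl s P H D → D ≤ P.length)) ∧
    -- the resulting rates, with an absolute constant
    (∃ C : ℝ, 0 < C ∧ ∀ (ε : ℝ) (fl : ℝ → ℝ), 0 ≤ ε → 12 * ε ≤ 1 → IsRounding fl ε →
      (∀ (P H : List Pt) (D : ℕ), QuickhullRun fl .simple P H D →
        forwardError H P ≤ C * (D * P.length * ε) ∧
        ((∀ x : ℝ, fl (-x) = -fl x) → forwardError H P ≤ C * ((P.length : ℝ) ^ 2 * ε))) ∧
      (∀ (m : ℕ+) (P H : List Pt) (D : ℕ), QuickhullRun fl (.blocked m) P H D →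
        forwardError H P ≤ C * (D * ((m : ℝ) + P.length / (m : ℝ)) * ε)) ∧
      (∀ (P H : List Pt) (D : ℕ), QuickhullRun fl .pairwise P H D →
        forwardError H P ≤ C * (D * Real.log P.length * ε))) := by
  refine ⟨fun ε fl s hε hε' h => ?_, 48, by norm_num, fun ε fl hε hε' h => ?_⟩
  · obtain ⟨hreduction, hquick, hhull⟩ := mainTheorem1_general.1 ε fl s hε' h
    have hγ := gamma6_nonneg hε hε'
    have hchain {n} (hn : 2 ≤ n) := le_mul_of_one_le_right hγ (one_le_chain s hn)
    have hquick {P H D} (hrun : QuickhullRun fl s P H D) {x} :=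
      le_two_mul_depth_mul (x := x) (hquick P H D hrun) hγ fun _ => hrun.one_le_depth
    refine ⟨hreduction, fun F hF P H D hx hrun => hquick hrun (fun hn => ?_) hx,
      fun P H D hrun => hquick hrun (fun _ => ?_) hchain,
      fun L p q H D hL hleft hrun => ?_, mainTheorem1_general.2 fl s⟩
    · exact mul_nonneg D.cast_nonneg (hn.antisymm hrun.one_le_length ▸ hF.apply_one_nonneg)
    · exact mul_nonneg D.cast_nonneg (mul_nonneg hγ (chain_nonneg s _))
    · have hstrip := fun u hu => Set.mem_uIcc.2 (hL.imp (· u hu) (· u hu))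
      have hhull {x} := le_two_mul_depth_mul (x := x) (hhull L p q H D hstrip hleft hrun) hγ
        hrun.one_le_depth fun hn => by simp [hrun.depth_eq_zero hn]
      exact ⟨hhull hchain, fun F _ => hhull⟩
  · have hquick {s P H D} (hrun : QuickhullRun fl s P H D) {κ} :=
      le_mul_depth_mul (κ := κ) ((mainTheorem1_general.1 ε fl s (by linarith) h).2.1 P H D hrun)
        hε hε' hrun.one_le_depth
    have hlinear {P H D} (hrun : QuickhullRun fl .simple P H D) :=
      hquick hrun P.length.cast_nonneg fun hn => by norm_cast; omega
    refine ⟨fun P H D hrun => ⟨hlinear hrun, fun hodd => (hlinear hrun).trans ?_⟩,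
      fun m P H D hrun => hquick hrun (chain_nonneg (.blocked m) _) fun hn => ?_,
      fun P H D hrun => hquick hrun (Real.log_natCast_nonneg _) one_le_two_mul_log⟩
    · rw [sq]
      gcongr
      exact hrun.depth_le hodd
    · linarith [show 1 ≤ (m : ℝ) + P.length / m from one_le_chain (.blocked m) hn]
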